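/- A translation surface $S$ is a closed connected surface obtained from finitely many simple polygons in $\mathbb R^2$ by gluing their sides in pairs by translations. Let $p\colon H_1(S,\mathbb Z)\to\mathbb R^2$, $p(\gamma)=\int_\gamma\omega$, be its holonomy map. For $g\in GL(2,\mathbb R)$ with $\det g>0$, $gS$ is the surface obtained by applying $g$ to the polygons. If a polygon $P$ has vertices $v_1,\dots,v_n$ in counterclockwise order, let $J(P)=v_1\wedge v_2+\dots+v_{n-1}\wedge v_n+v_n\wedge v_1\in\mathbb R^2\wedge_{\mathbb Q}\mathbb R^2$, and let $J(S)=\sum_P J(P)$ over the polygons of $S$. Let $J_{xx},J_{yy}$ (with values in $\mathbb R\wedge_{\mathbb Q}\mathbb R$) and $J_{xy},J_{yx}$ (with values in $\mathbb R\otimes_{\mathbb Q}\mathbb R$) be the images of $J$ under the $\mathbb Q$-linear maps which send $\binom ab\wedge\binom{a'}{b'}$ to $a\wedge a'$, $b\wedge b'$, $a\otimes b'-a'\otimes b$ and $b\otimes a'-b'\otimes a$, respectively. For a direction $v$ (a nonzero vector up to nonzero real multiples) put $J_{vv}(S)=J_{xx}(S)$ if $v$ is vertical, and otherwise $J_{vv}(S)=J_{yy}(gS)$,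 where $v$ is represented by $\binom1q$ and $g\in SL(2,\mathbb R)$ satisfies $g\binom1q=\binom10$ (this does not depend on $g$). For linearly independent directions $v,w$ put $J_{vw}(S)=J_{yx}(S)$ if $v$ is vertical and $w$ is horizontal, and otherwise $J_{vw}(S)=J_{xy}(gS)$, where $v',w'$ are vectors in the directions $v,w$ for which there is a $g\in SL(2,\mathbb R)$ with $gv'=\binom10$, $gw'=\binom01$; this value depends on the choice of $v',w'$. The surface $S$ has Property X if $J_{vv}(S)=0$ for every homological direction $v$, that is, for every $v\neq0$ such that $rv=p(\lambda)$ for some $\lambda\in H_1(S,\mathbb Z)$ and some real $r\neq0$. Proposition. Let $d$ be a positive integer which is not a perfect square, and let $S$ be a translation surface with $p(H_1(S,\mathbb Z))\subset\mathbb Q(\sqrt d)\times\mathbb Q(\sqrt d)$. Suppose that there is no $g\in GL(2,\mathbb R)$ with $\det g>0$ and $p(H_1(gS,\mathbb Z))\subset\mathbb Q\times\mathbb Q$. Let $v,w$ be linearly independent directions with $J_{vv}(S)=J_{ww}(S)=0$. Then for a suitable choice of $v',w'$ there are $c_1,c_2,c_3,c_4\in\mathbb Q$ with $$J_{vw}(S)=c_1(1\otimes1)+c_2(1\otimes\sqrt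 d)+c_3(\sqrt d\otimes1)+c_4(\sqrt d\otimes\sqrt d).\qquad(*)$$ Moreover, for every choice of $v',w'$ and all $c_1,\dots,c_4\in\mathbb Q$ such that $(*)$ holds, $S$ has Property X if and only if $c_2=c_3$ and $c_1=d\,c_4$. -/

import Mathlib

open scoped TensorProduct

noncomputable section

/-! ### Simple polygons in the plane -/

/-- The plane `ℝ²`, used as a vector space only. -/
abbrev Plane : Type := Fin 2 → ℝ

/-- The signed area of a closed polygon (shoelace formula); it is positive exactly when the
vertices of a simple polygon are listed in counterclockwise order. -/
def Polygon.signedArea {n : ℕ} (P : Polygon Plane n) : ℝ :=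
  (1 / 2) * ∑ k : Fin n, (P k 0 * P (finRotate n k) 1 - P (finRotate n k) 0 * P k 1)

/-- A simple polygon in the plane with its `n` vertices listed in counterclockwise order. The `k`-th edge runs
from the `k`-th vertex to the (cyclically) next one. Vertices with angle `π` are allowed. -/
structure SimplePolygon (n : ℕ) where
  /-- the vertices -/
  poly : Polygon Plane n
  /-- the closed boundary curve has no self-intersections (and no constant edge) -/
  simple : ∀ i j : Fin n, ∀ s ∈ Set.Ico (0 : ℝ) 1, ∀ t ∈ Set.Ico (0 : ℝ) 1,
    poly.edgePath ℝ i s = poly.edgePath ℝ j t → i = j ∧ s = t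
  /-- the vertices are in counterclockwise order -/
  ccw : 0 < poly.signedArea

namespace SimplePolygon

variable {n : ℕ}

/-- The `k`-th edge vector, with the boundary oriented counterclockwise. -/
def edgeVec (P : SimplePolygon n) (k : Fin n) : Plane :=
  P.poly (finRotate n k) - P.poly k

theorem sum_edgeVec (P : SimplePolygon n) : ∑ k, P.edgeVec k = 0 := by
  simp only [edgeVec, Finset.sum_sub_distrib]
  rw [Equiv.sum_comp (finRotate n) (fun k => P.poly k), sub_self]

/-- The image `A P` of a polygon under a matrix `A` of positive determinant. -/
def act (A : Matrix (Fin 2) (Fin 2) ℝ) (hA : 0 < A.det) (P : SimplePolygon n) :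
    SimplePolygon n where
  poly := ⟨fun k => A.mulVec (P.poly k)⟩
  simple := by
    intro i j s hs t ht h
    refine P.simple i j s hs t ht ?_
    have hinj : Function.Injective A.mulVec :=
      Matrix.mulVec_injective_iff_isUnit.2 ((Matrix.isUnit_iff_isUnit_det A).2 hA.ne'.isUnit)
    apply hinj
    simp only [Polygon.edgePath, AffineMap.lineMap_apply, vsub_eq_sub, vadd_eq_add,
      Matrix.mulVec_add, Matrix.mulVec_smul, Matrix.mulVec_sub] at h ⊢
    exact h
  ccw := by
    refine (mul_pos hA P.ccw).trans_eq ?_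
    unfold Polygon.signedArea
    rw [Finset.mul_sum, Finset.mul_sum, Finset.mul_sum]
    refine Finset.sum_congr rfl fun k _ => ?_
    simp only [Matrix.mulVec, dotProduct, Fin.sum_univ_two, Matrix.det_fin_two]
    ring

theorem act_edgeVec (A : Matrix (Fin 2) (Fin 2) ℝ) (hA : 0 < A.det) (P : SimplePolygon n)
    (k : Fin n) : (P.act A hA).edgeVec k = A.mulVec (P.edgeVec k) := by
  simp only [edgeVec, Matrix.mulVec_sub]
  rfl

end SimplePolygon

/-! ### Translation surfaces -/

/-- A translation surface, given by finitely many simple polygons in the plane whose sides are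
glued in pairs by translations. Two paired sides have opposite edge vectors (all polygons being
oriented counterclockwise), so the polygons lie on opposite sides of the glued edge. The resulting
closed surface is required to be connected. -/
structure TranslationSurface where
  /-- the number of polygons -/
  numPolygons : ℕ
  /-- the number of sides of each polygon -/
  numSides : Fin numPolygons → ℕ
  /-- the polygons -/
  polygon : ∀ i, SimplePolygon (numSides i)
  /-- the pairing of the sides -/
  glue : (Σ i, Fin (numSides i)) → (Σ i, Fin (numSides i))
  /-- the pairing is an involution -/
  glue_glue : ∀ e, glue (glue e) = e
  /-- paired sides are parallel, of the same length, and carry opposite boundary orientations -/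
  glue_vec : ∀ e, (polygon (glue e).1).edgeVec (glue e).2 = -(polygon e.1).edgeVec e.2
  /-- there is at least one polygon -/
  numPolygons_pos : 0 < numPolygons
  /-- the surface is connected -/
  connected : ∀ i j, Relation.ReflTransGen
    (fun a b => ∃ e : Σ i, Fin (numSides i), e.1 = a ∧ (glue e).1 = b) i j

namespace TranslationSurface

/-- The oriented sides of the polygons. The side `⟨i, k⟩` starts at the `k`-th corner of the `i`-th
polygon, so this type also indexes the corners of the polygons. -/
abbrev Side (S : TranslationSurface) : Type := Σ i, Fin (S.numSides i)

/-- The vector of an oriented side. -/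
def vec (S : TranslationSurface) (e : S.Side) : Plane := (S.polygon e.1).edgeVec e.2

/-- The next side along the boundary of the same polygon. -/
def next (S : TranslationSurface) (e : S.Side) : S.Side := ⟨e.1, finRotate _ e.2⟩

/-- The surface `A S`, obtained by applying a matrix `A` of positive determinant to all polygons
and keeping the gluing. -/
def act (A : Matrix (Fin 2) (Fin 2) ℝ) (hA : 0 < A.det) (S : TranslationSurface) :
    TranslationSurface where
  numPolygons := S.numPolygons
  numSides := S.numSides
  polygon i := (S.polygon i).act A hA
  glue := S.glue
  glue_glue := S.glue_glue
  glue_vec e := by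
    rw [SimplePolygon.act_edgeVec, SimplePolygon.act_edgeVec]
    exact (congrArg A.mulVec (S.glue_vec e)).trans (Matrix.mulVec_neg _ _)
  numPolygons_pos := S.numPolygons_pos
  connected := S.connected

/-- The action of `SL(2, ℝ)` on translation surfaces. -/
def actSL (g : Matrix.SpecialLinearGroup (Fin 2) ℝ) (S : TranslationSurface) :
    TranslationSurface :=
  S.act g.1 (by rw [g.2]; exact one_pos)

/-! ### First homology (of the cell structure given by the polygons) and holonomy -/

/-- Two corners are identified by gluing when they are related by the equivalence relation which
identifies the start of each side with the end of its partner. -/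
def cornerSetoid (S : TranslationSurface) : Setoid S.Side :=
  Relation.EqvGen.setoid (fun c c' => c' = S.next (S.glue c))

/-- The vertices of the surface. -/
def Vertex (S : TranslationSurface) : Type := Quotient S.cornerSetoid

/-- The vertex at the start of a side. -/
def start (S : TranslationSurface) (e : S.Side) : S.Vertex := Quotient.mk S.cornerSetoid e

/-- The vertex at the end of a side. -/
def finish (S : TranslationSurface) (e : S.Side) : S.Vertex := S.start (S.next e)

theorem start_eq_finish_glue (S : TranslationSurface) (e : S.Side) :
    S.start e = S.finish (S.glue e) :=
  Quotient.sound (s := S.cornerSetoid) (Relation.EqvGen.rel _ _ rfl)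

theorem finish_eq_start_glue (S : TranslationSurface) (e : S.Side) :
    S.finish e = S.start (S.glue e) := by
  rw [start_eq_finish_glue, S.glue_glue]

/-- The relations `e + glue e = 0` between oriented sides. -/
def sideRelations (S : TranslationSurface) : Submodule ℤ (S.Side →₀ ℤ) :=
  Submodule.span ℤ (Set.range fun e => Finsupp.single e 1 + Finsupp.single (S.glue e) 1)

/-- Cellular `1`-chains: the free abelian group on the oriented sides, where a side and its partner
are the same edge of the surface with opposite orientations. -/
abbrev Chain1 (S : TranslationSurface) : Type := (S.Side →₀ ℤ) ⧸ S.sideRelations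

/-- The `1`-chain of an oriented side. -/
def sideChain (S : TranslationSurface) (e : S.Side) : S.Chain1 :=
  S.sideRelations.mkQ (Finsupp.single e 1)

/-- A function on oriented sides which changes sign when a side is replaced by its partner extends
to `1`-chains. -/
def liftChain (S : TranslationSurface) {N : Type} [AddCommGroup N] (f : S.Side → N)
    (hf : ∀ e, f e + f (S.glue e) = 0) : S.Chain1 →ₗ[ℤ] N :=
  S.sideRelations.liftQ (Finsupp.linearCombination ℤ f) (by
    rw [sideRelations, Submodule.span_le]
    rintro _ ⟨e, rfl⟩
    simp [hf])

theorem liftChain_sideChain (S : TranslationSurface) {N : Type} [AddCommGroup N] (f : S.Side → N)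
    (hf : ∀ e, f e + f (S.glue e) = 0) (e : S.Side) :
    S.liftChain f hf (S.sideChain e) = f e := by
  simp [liftChain, sideChain]

/-- The boundary of `1`-chains, `∂ e = finish e - start e`. -/
def boundary1 (S : TranslationSurface) : S.Chain1 →ₗ[ℤ] (S.Vertex →₀ ℤ) :=
  S.liftChain (fun e => Finsupp.single (S.finish e) 1 - Finsupp.single (S.start e) 1) (fun e => by
    rw [S.start_eq_finish_glue e, S.finish_eq_start_glue e]
    abel)

/-- The boundary of `2`-chains: a polygon is sent to the sum of its sides. -/
def boundary2 (S : TranslationSurface) : (Fin S.numPolygons →₀ ℤ) →ₗ[ℤ] S.Chain1 :=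
  Finsupp.linearCombination ℤ (fun i => ∑ k, S.sideChain ⟨i, k⟩)

theorem boundary1_boundary2 (S : TranslationSurface) (c : Fin S.numPolygons →₀ ℤ) :
    S.boundary1 (S.boundary2 c) = 0 := by
  suffices h : S.boundary1 ∘ₗ S.boundary2 = 0 from LinearMap.congr_fun h c
  ext1 i
  ext1
  simp only [LinearMap.comp_apply, boundary2, Finsupp.lsingle_apply,
    Finsupp.linearCombination_single, one_smul, map_sum, boundary1, liftChain_sideChain,
    Finset.sum_sub_distrib, LinearMap.zero_apply]
  rw [sub_eq_zero]
  exact Equiv.sum_comp (finRotate (S.numSides i))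
    (fun k => (Finsupp.single (S.start ⟨i, k⟩) 1 : S.Vertex →₀ ℤ))

/-- The first homology group `H₁(S, ℤ)`: cycles modulo boundaries. -/
abbrev H1 (S : TranslationSurface) : Type :=
  ↥(LinearMap.ker S.boundary1) ⧸
    (LinearMap.range S.boundary2).comap (LinearMap.ker S.boundary1).subtype

/-- Holonomy of `1`-chains: the integral over a side of the form `ω` is its vector. -/
def chainPeriod (S : TranslationSurface) : S.Chain1 →ₗ[ℤ] Plane :=
  S.liftChain S.vec (fun e => by
    rw [vec, vec, S.glue_vec, add_neg_cancel])

theorem chainPeriod_boundary2 (S : TranslationSurface) (c : Fin S.numPolygons →₀ ℤ) :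
    S.chainPeriod (S.boundary2 c) = 0 := by
  suffices h : S.chainPeriod ∘ₗ S.boundary2 = 0 from LinearMap.congr_fun h c
  ext1 i
  ext1
  simp only [LinearMap.comp_apply, boundary2, Finsupp.lsingle_apply,
    Finsupp.linearCombination_single, one_smul, map_sum, chainPeriod, liftChain_sideChain,
    LinearMap.zero_apply]
  exact (S.polygon i).sum_edgeVec

/-- The holonomy (period) map `p : H₁(S, ℤ) → ℝ²`, `p(γ) = ∫_γ ω`. -/
def period (S : TranslationSurface) : S.H1 →ₗ[ℤ] Plane :=
  ((LinearMap.range S.boundary2).comap (LinearMap.ker S.boundary1).subtype).liftQ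
    (S.chainPeriod ∘ₗ (LinearMap.ker S.boundary1).subtype) (by
      rintro z ⟨c, hc⟩
      rw [LinearMap.mem_ker, LinearMap.comp_apply, ← hc]
      exact S.chainPeriod_boundary2 c)

/-! ### Quadratic surfaces and rescaling -/

/-- `S` is quadratic with field `ℚ(√d)`: the positive integer `d` is not a perfect square and
`p(H₁(S, ℤ)) ⊆ ℚ(√d) × ℚ(√d)`. -/
def IsQuadraticWith (S : TranslationSurface) (d : ℕ) : Prop :=
  0 < d ∧ ¬ IsSquare d ∧
    ∀ (c : S.H1) (i : Fin 2), S.period c i ∈ IntermediateField.adjoin ℚ {Real.sqrt (d : ℝ)}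

/-- `p(H₁(S, ℤ)) ⊆ ℚ × ℚ`. -/
def HasRationalPeriods (S : TranslationSurface) : Prop :=
  ∀ (c : S.H1) (i : Fin 2), ∃ q : ℚ, S.period c i = q

/-- `S` can be rescaled, i.e. moved by an orientation-preserving linear map of the plane, so that
its periods lie in `ℚ × ℚ`. -/
def RescalableToRational (S : TranslationSurface) : Prop :=
  ∃ (A : Matrix (Fin 2) (Fin 2) ℝ) (hA : 0 < A.det), (S.act A hA).HasRationalPeriods

/-! ### The Kenyon-Smillie invariant and its projections -/

/-- `J(S) = ∑ J(P)` over the polygons of `S`, where `J(P) = v₁ ∧ v₂ + ⋯ + vₙ ∧ v₁` in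
`ℝ² ∧_ℚ ℝ²` for a polygon with vertices `v₁, …, vₙ` in counterclockwise order. -/
def J (S : TranslationSurface) : ⋀[ℚ]^2 Plane :=
  ∑ i, ∑ k : Fin (S.numSides i),
    exteriorPower.ιMulti ℚ 2
      ![(S.polygon i).poly k, (S.polygon i).poly (finRotate _ k)]

end TranslationSurface

namespace KenyonSmillie

/-- `J_xx : (a, b) ∧ (c, d) ↦ a ∧ c`. -/
def Jxx : ⋀[ℚ]^2 Plane →ₗ[ℚ] ⋀[ℚ]^2 ℝ :=
  exteriorPower.map 2 (LinearMap.proj 0)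

/-- `J_yy : (a, b) ∧ (c, d) ↦ b ∧ d`. -/
def Jyy : ⋀[ℚ]^2 Plane →ₗ[ℚ] ⋀[ℚ]^2 ℝ :=
  exteriorPower.map 2 (LinearMap.proj 1)

/-- The alternating map `(u, v) ↦ uᵢ ⊗ vⱼ - vᵢ ⊗ uⱼ`. -/
def crossAlt (i j : Fin 2) : Plane [⋀^Fin 2]→ₗ[ℚ] (ℝ ⊗[ℚ] ℝ) where
  toFun m := m 0 i ⊗ₜ[ℚ] m 1 j - m 1 i ⊗ₜ[ℚ] m 0 j
  map_update_add' m k x y := by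
    fin_cases k <;> simp [TensorProduct.add_tmul, TensorProduct.tmul_add] <;> abel
  map_update_smul' m k c x := by
    fin_cases k <;>
      simp [TensorProduct.smul_tmul', TensorProduct.tmul_smul, smul_sub]
  map_eq_zero_of_eq' m k l h hkl := by
    have h01 : m 0 = m 1 := by
      fin_cases k <;> fin_cases l <;> simp_all
    simp [h01]

/-- `J_xy : (a, b) ∧ (c, d) ↦ a ⊗ d - c ⊗ b`. -/
def Jxy : ⋀[ℚ]^2 Plane →ₗ[ℚ] (ℝ ⊗[ℚ] ℝ) :=
  exteriorPower.alternatingMapLinearEquiv (crossAlt 0 1)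

/-- `J_yx : (a, b) ∧ (c, d) ↦ b ⊗ c - d ⊗ a`. -/
def Jyx : ⋀[ℚ]^2 Plane →ₗ[ℚ] (ℝ ⊗[ℚ] ℝ) :=
  exteriorPower.alternatingMapLinearEquiv (crossAlt 1 0)

/-- The element `[1 0; -q 1]` of `SL(2, ℝ)`, which sends `(1, q)` to `(1, 0)`. -/
def shear (q : ℝ) : Matrix.SpecialLinearGroup (Fin 2) ℝ :=
  ⟨!![1, 0; -q, 1], by simp [Matrix.det_fin_two]⟩

end KenyonSmillie

namespace TranslationSurface

open KenyonSmillie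

/-- `J_vv(S)`, for the direction of a nonzero vector `v`. For the vertical direction it is
`J_xx(S)`. Otherwise the direction is represented by `(1, q)`, and `J_vv(S) = J_yy(g S)` for
`g ∈ SL(2, ℝ)` with `g (1, q) = (1, 0)`; for the horizontal direction this is `J_yy(S)`. -/
def Jvv (S : TranslationSurface) (v : Plane) : ⋀[ℚ]^2 ℝ :=
  if v 0 = 0 then Jxx S.J else Jyy (S.actSL (shear (v 1 / v 0))).J

/-- `J_vv` does not depend on the choice of `g`. -/
theorem Jvv_eq (S : TranslationSurface) (v : Plane) (hv : v 0 ≠ 0)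
    (g : Matrix.SpecialLinearGroup (Fin 2) ℝ) (hg : g.1.mulVec ![1, v 1 / v 0] = ![1, 0]) :
    S.Jvv v = Jyy (S.actSL g).J := by
  have h0 := congrFun hg 0
  have h1 := congrFun hg 1
  have hd := g.2
  simp only [Matrix.mulVec, dotProduct, Fin.sum_univ_two, Matrix.det_fin_two, Matrix.cons_val_zero,
    Matrix.cons_val_one] at h0 h1 hd
  have h11 : g.1 1 1 = 1 := by linear_combination hd - g.1 1 1 * h0 + g.1 0 1 * h1
  have h10 : g.1 1 0 = -(v 1 / v 0) := by rw [h11] at h1; linear_combination h1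
  rw [Jvv, if_neg hv]
  simp only [J, map_sum, Jyy, exteriorPower.map_apply_ιMulti]
  refine Finset.sum_congr rfl fun i _ => Finset.sum_congr rfl fun k _ => congrArg _ ?_
  funext j
  fin_cases j <;>
    simp [actSL, act, SimplePolygon.act, shear, dotProduct, Fin.sum_univ_two, h11, h10]
  all_goals rfl

/-- `T` is a value of `J_vw(S)` for the directions of `v` and `w`. If `v` is vertical and `w` is
horizontal this means `T = J_yx(S)`; otherwise it means `T = J_xy(g S)` for some `g ∈ SL(2, ℝ)`
sending some vector in the direction `v` to `(1, 0)` and some vector in the direction `w` to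
`(0, 1)`. (The value depends on the choice of these vectors.) -/
def IsJvw (S : TranslationSurface) (v w : Plane) (T : ℝ ⊗[ℚ] ℝ) : Prop :=
  (v 0 = 0 ∧ w 1 = 0 ∧ T = Jyx S.J) ∨
  (¬ (v 0 = 0 ∧ w 1 = 0) ∧
    ∃ (a b : ℝ) (g : Matrix.SpecialLinearGroup (Fin 2) ℝ), a ≠ 0 ∧ b ≠ 0 ∧
      g.1.mulVec (a • v) = ![1, 0] ∧ g.1.mulVec (b • w) = ![0, 1] ∧ T = Jxy (S.actSL g).J)

/-- The direction of the nonzero vector `v` is homological: a nonzero multiple of `v` is the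
period of a homology class. -/
def IsHomological (S : TranslationSurface) (v : Plane) : Prop :=
  v ≠ 0 ∧ ∃ (c : S.H1) (r : ℝ), r ≠ 0 ∧ r • v = S.period c

/-- Property X: `J_vv(S) = 0` for every homological direction `v`. -/
def PropertyX (S : TranslationSurface) : Prop :=
  ∀ v : Plane, S.IsHomological v → S.Jvv v = 0

end TranslationSurface

/-- `c₁ (1 ⊗ 1) + c₂ (1 ⊗ √d) + c₃ (√d ⊗ 1) + c₄ (√d ⊗ √d)` in `ℝ ⊗_ℚ ℝ`. -/
def quadTensor (d : ℕ) (c₁ c₂ c₃ c₄ : ℚ) : ℝ ⊗[ℚ] ℝ :=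
  c₁ • ((1 : ℝ) ⊗ₜ[ℚ] (1 : ℝ)) + c₂ • ((1 : ℝ) ⊗ₜ[ℚ] Real.sqrt d) +
    c₃ • (Real.sqrt d ⊗ₜ[ℚ] (1 : ℝ)) + c₄ • (Real.sqrt d ⊗ₜ[ℚ] Real.sqrt d)

end

section Wedge

/-- The wedge product of two vectors, as a bilinear map. -/
noncomputable def wedge {M : Type} [AddCommGroup M] [Module ℚ M] : M →ₗ[ℚ] M →ₗ[ℚ] ⋀[ℚ]^2 M :=
  LinearMap.mk₂ ℚ (fun u v => exteriorPower.ιMulti ℚ 2 ![u, v])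
    (fun u u' v => (exteriorPower.ιMulti ℚ 2).map_vecCons_add ![v] u u')
    (fun c u v => (exteriorPower.ιMulti ℚ 2).map_vecCons_smul ![v] c u)
    (fun u v v' => by
      have h : ∀ w, ![u, w] = Function.update ![u, v] 1 w := fun w => by
        ext i : 1
        fin_cases i <;> rfl
      rw [h (v + v'), h v', AlternatingMap.map_update_add]
      rfl)
    (fun c u v => by
      have h : ∀ w, ![u, w] = Function.update ![u, v] 1 w := fun w => by
        ext i : 1
        fin_cases i <;> rfl
      rw [h (c • v), AlternatingMap.map_update_smul, ← h v])

variable {M N : Type} [AddCommGroup M] [Module ℚ M] [AddCommGroup N] [Module ℚ N]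

theorem ιMulti_eq_wedge (u v : M) : exteriorPower.ιMulti ℚ 2 ![u, v] = wedge u v := rfl

theorem wedge_self (u : M) : wedge u u = 0 :=
  (exteriorPower.ιMulti ℚ 2 (M := M)).map_eq_zero_of_eq ![u, u] (i := 0) (j := 1) rfl (by decide)

theorem wedge_swap (u v : M) : wedge v u = -wedge u v := by
  have h := wedge_self (u + v)
  simp only [map_add, LinearMap.add_apply, wedge_self, zero_add, add_zero] at h
  exact eq_neg_of_add_eq_zero_left h

theorem map_wedge (f : M →ₗ[ℚ] N) (u v : M) :
    exteriorPower.map 2 f (wedge u v) = wedge (f u) (f v) := by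
  rw [← ιMulti_eq_wedge, exteriorPower.map_apply_ιMulti, ← ιMulti_eq_wedge]
  congr 1
  ext i
  fin_cases i <;> rfl

theorem alternatingMapLinearEquiv_wedge (f : M [⋀^Fin 2]→ₗ[ℚ] N) (u v : M) :
    exteriorPower.alternatingMapLinearEquiv f (wedge u v) = f ![u, v] := by
  rw [← ιMulti_eq_wedge, exteriorPower.alternatingMapLinearEquiv_apply_ιMulti]

end Wedge

/-- If a function on a cycle of length `n` changes by elements of `H` at each step, then all its
differences lie in `H`. -/
theorem sub_mem_of_forall_finRotate_sub_mem {M : Type} [AddCommGroup M] (H : Submodule ℤ M) {n : ℕ}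
    (f : Fin n → M) (hf : ∀ k, f (finRotate n k) - f k ∈ H) (j k : Fin n) : f j - f k ∈ H := by
  cases n with
  | zero => exact j.elim0
  | succ n =>
    have key : ∀ i : Fin (n + 1), f i - f 0 ∈ H := by
      intro i
      induction i using Fin.induction with
      | zero => simp
      | succ i ih =>
        have h := hf i.castSucc
        rw [finRotate_apply, Fin.coeSucc_eq_succ] at h
        simpa using H.add_mem h ih
    simpa using H.sub_mem (key j) (key k)

namespace TranslationSurface

/-- The cyclic permutation of the sides along the boundary of each polygon. -/
def nextEquiv (S : TranslationSurface) : S.Side ≃ S.Side :=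
  Equiv.sigmaCongrRight fun i => finRotate (S.numSides i)

/-- The gluing as a permutation of the sides. -/
def glueEquiv (S : TranslationSurface) : S.Side ≃ S.Side :=
  ⟨S.glue, S.glue, S.glue_glue, S.glue_glue⟩

/-- The corner at the start of a side. -/
def corner (S : TranslationSurface) (e : S.Side) : Plane := (S.polygon e.1).poly e.2

theorem vec_eq (S : TranslationSurface) (e : S.Side) :
    S.vec e = S.corner (S.next e) - S.corner e := rfl

theorem J_eq_sum_corner (S : TranslationSurface) :
    S.J = ∑ e, wedge (S.corner e) (S.corner (S.next e)) := by
  rw [Fintype.sum_sigma]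
  rfl

theorem vec_glue (S : TranslationSurface) (e : S.Side) : S.vec (S.glue e) = -S.vec e :=
  S.glue_vec e

/-- The lattice of periods may be reached from every edge by subtracting the difference of a
function at its endpoints. -/
theorem exists_vertex_potential (S : TranslationSurface) : ∃ t : S.Vertex → Plane,
    ∀ e, S.vec e - t (S.finish e) + t (S.start e) ∈ LinearMap.range S.period := by
  classical
  let r : Setoid S.Vertex :=
    { r := fun x y => (Finsupp.single y 1 - Finsupp.single x 1 : S.Vertex →₀ ℤ) ∈
        LinearMap.range S.boundary1
      iseqv :=
        { refl := fun x => by simp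
          symm := fun {x y} h => by simpa using Submodule.neg_mem _ h
          trans := fun {x y z} h h' => by simpa using Submodule.add_mem _ h' h } }
  let o : S.Vertex → S.Vertex := fun x => (Quotient.mk r x).out
  have ho : ∀ x, ∃ c, S.boundary1 c = Finsupp.single x 1 - Finsupp.single (o x) 1 :=
    fun x => Quotient.exact (s := r) (Quotient.out_eq (Quotient.mk r x))
  choose c hc using ho
  refine ⟨fun x => S.chainPeriod (c x), fun e => ?_⟩
  have hb : S.boundary1 (S.sideChain e) =
      Finsupp.single (S.finish e) 1 - Finsupp.single (S.start e) 1 := by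
    rw [boundary1, liftChain_sideChain]
  have hse : o (S.start e) = o (S.finish e) :=
    congrArg Quotient.out (Quotient.sound (s := r) ⟨S.sideChain e, hb⟩)
  have hz : S.boundary1 (S.sideChain e - c (S.finish e) + c (S.start e)) = 0 := by
    rw [map_add, map_sub, hb, hc, hc, hse]
    abel
  refine ⟨Submodule.Quotient.mk ⟨_, hz⟩, ?_⟩
  have hv : S.chainPeriod (S.sideChain e) = S.vec e := by
    rw [chainPeriod, liftChain_sideChain]
  simp only [period, Submodule.liftQ_apply, LinearMap.comp_apply, Submodule.subtype_apply, map_add,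
    map_sub, hv]

theorem sum_wedge_sub_translation (S : TranslationSurface) (f : S.Side → Plane)
    (b : Fin S.numPolygons → Plane) :
    ∑ e, wedge (f e - b e.1) (f (S.next e) - b e.1) = ∑ e, wedge (f e) (f (S.next e)) := by
  rw [Fintype.sum_sigma, Fintype.sum_sigma]
  refine Finset.sum_congr rfl fun i _ => ?_
  have h : ∑ k, f (S.next ⟨i, k⟩) = ∑ k, f ⟨i, k⟩ :=
    Equiv.sum_comp (finRotate (S.numSides i)) (fun k => f ⟨i, k⟩)
  have h1 : ∑ k, wedge (f ⟨i, k⟩) (b i) = wedge (∑ k, f ⟨i, k⟩) (b i) := by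
    simp [map_sum, LinearMap.sum_apply]
  have h2 : ∑ k, wedge (b i) (f (S.next ⟨i, k⟩)) = wedge (b i) (∑ k, f ⟨i, k⟩) := by
    rw [← h, map_sum]
  simp only [map_sub, LinearMap.sub_apply, wedge_self, Finset.sum_sub_distrib, h1, h2]
  rw [wedge_swap (b i) (∑ k, f ⟨i, k⟩)]
  simp only [Finset.sum_const_zero]
  abel

theorem sum_wedge_sub_potential (S : TranslationSurface) (t : S.Vertex → Plane) :
    ∑ e, wedge (S.corner e - t (S.start e)) (S.corner (S.next e) - t (S.finish e)) = S.J := by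
  have hg : ∀ g : S.Side → ⋀[ℚ]^2 Plane, ∑ e, g (S.glue e) = ∑ e, g e :=
    fun g => Equiv.sum_comp S.glueEquiv g
  have hn : ∀ g : S.Side → ⋀[ℚ]^2 Plane, ∑ e, g (S.next e) = ∑ e, g e :=
    fun g => Equiv.sum_comp S.nextEquiv g
  have h1 : ∑ e, wedge (t (S.start e)) (t (S.finish e)) = 0 := by
    have h := hg fun e => wedge (t (S.start e)) (t (S.finish e))
    simp only [← S.finish_eq_start_glue, ← S.start_eq_finish_glue] at h
    simp only [fun e => wedge_swap (t (S.start e)) (t (S.finish e)), Finset.sum_neg_distrib] at h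
    have h' : (2 : ℚ) • ∑ e, wedge (t (S.start e)) (t (S.finish e)) = 0 := by
      rw [two_smul]
      nth_rw 1 [← h]
      exact neg_add_cancel _
    exact (smul_eq_zero.1 h').resolve_left two_ne_zero
  have h2 : ∑ e, wedge (t (S.finish e)) (S.vec e) = -∑ e, wedge (t (S.start e)) (S.vec e) := by
    rw [← hg fun e => wedge (t (S.finish e)) (S.vec e), ← Finset.sum_neg_distrib]
    refine Finset.sum_congr rfl fun e _ => ?_
    rw [← S.start_eq_finish_glue, vec_glue, map_neg]
  have h3 := hn fun e => wedge (t (S.start e)) (S.corner e)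
  change ∑ e, wedge (t (S.finish e)) (S.corner (S.next e)) = _ at h3
  rw [J_eq_sum_corner]
  simp only [vec_eq, map_sub, Finset.sum_sub_distrib] at h2
  simp only [map_sub, LinearMap.sub_apply, Finset.sum_sub_distrib, h1,
    fun e => wedge_swap (t (S.finish e)) (S.corner e), Finset.sum_neg_distrib]
  rw [h3, neg_sub, sub_right_inj] at h2
  rw [← h2]
  abel

/-- The Kenyon-Smillie invariant comes from the exterior square of the group of periods. -/
theorem exists_J_eq_sum_wedge_period (S : TranslationSurface) : ∃ x y : S.Side → Plane,
    (∀ e, x e ∈ LinearMap.range S.period) ∧ (∀ e, y e ∈ LinearMap.range S.period) ∧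
    S.J = ∑ e, wedge (x e) (y e) := by
  obtain ⟨t, ht⟩ := S.exists_vertex_potential
  let f : S.Side → Plane := fun e => S.corner e - t (S.start e)
  have hf : ∀ (i) (k : Fin (S.numSides i)),
      f ⟨i, finRotate _ k⟩ - f ⟨i, k⟩ ∈ LinearMap.range S.period := by
    intro i k
    have h := ht ⟨i, k⟩
    rw [vec_eq] at h
    convert h using 1
    simp only [f]
    change S.corner (S.next ⟨i, k⟩) - t (S.finish ⟨i, k⟩) - _ = _
    abel
  have hb : ∀ i, ∃ b, ∀ k, f ⟨i, k⟩ - b ∈ LinearMap.range S.period := by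
    intro i
    rcases isEmpty_or_nonempty (Fin (S.numSides i)) with h | ⟨⟨k⟩⟩
    · exact ⟨0, fun k => h.elim k⟩
    · exact ⟨f ⟨i, k⟩, fun j => sub_mem_of_forall_finRotate_sub_mem _ (fun k => f ⟨i, k⟩) (hf i) j k⟩
  choose b hb using hb
  refine ⟨fun e => f e - b e.1, fun e => f (S.next e) - b e.1, fun e => hb e.1 e.2,
    fun e => hb e.1 _, ?_⟩
  rw [sum_wedge_sub_translation, ← S.sum_wedge_sub_potential t]
  rfl

theorem J_act (S : TranslationSurface) (A : Matrix (Fin 2) (Fin 2) ℝ) (hA : 0 < A.det) :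
    (S.act A hA).J = exteriorPower.map 2 (A.mulVecLin.restrictScalars ℚ) S.J := by
  rw [J_eq_sum_corner, J_eq_sum_corner, map_sum]
  simp only [map_wedge]
  rfl

/-- Multiplying out `J_xy` gives twice the area, which is positive. -/
theorem area_pos (S : TranslationSurface) :
    0 < LinearMap.mul' ℚ ℝ (KenyonSmillie.Jxy S.J) := by
  have h : LinearMap.mul' ℚ ℝ (KenyonSmillie.Jxy S.J) =
      ∑ i, 2 * (S.polygon i).poly.signedArea := by
    rw [J_eq_sum_corner, Fintype.sum_sigma, map_sum, map_sum]
    refine Finset.sum_congr rfl fun i _ => ?_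
    rw [map_sum, map_sum, Polygon.signedArea, ← mul_assoc, mul_one_div_cancel two_ne_zero, one_mul]
    refine Finset.sum_congr rfl fun k _ => ?_
    rw [KenyonSmillie.Jxy, alternatingMapLinearEquiv_wedge]
    simp [KenyonSmillie.crossAlt, corner, next]
  rw [h]
  have : Nonempty (Fin S.numPolygons) := ⟨⟨0, S.numPolygons_pos⟩⟩
  exact Finset.sum_pos (fun i _ => mul_pos two_pos (S.polygon i).ccw) Finset.univ_nonempty

end TranslationSurface

section Quadratic

/-- The elements of `ℚ(√d)` are the numbers `x + y √d`. -/
theorem mem_adjoin_sqrt_iff (d : ℕ) (z : ℝ) :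
    z ∈ IntermediateField.adjoin ℚ {Real.sqrt (d : ℝ)} ↔ ∃ x y : ℚ, z = x + y * Real.sqrt d := by
  have hs : Real.sqrt d * Real.sqrt d = d := Real.mul_self_sqrt (Nat.cast_nonneg d)
  constructor
  · intro hz
    induction hz using IntermediateField.adjoin_induction with
    | mem x hx => exact ⟨0, 1, by simp [Set.mem_singleton_iff.1 hx]⟩
    | algebraMap q => exact ⟨q, 0, by simp⟩
    | add x y _ _ hx hy =>
      obtain ⟨a, b, rfl⟩ := hx
      obtain ⟨a', b', rfl⟩ := hy
      exact ⟨a + a', b + b', by push_cast; ring⟩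
    | mul x y _ _ hx hy =>
      obtain ⟨a, b, rfl⟩ := hx
      obtain ⟨a', b', rfl⟩ := hy
      exact ⟨a * a' + d * b * b', a * b' + b * a', by push_cast; linear_combination (b * b' : ℝ) * hs⟩
    | inv x _ hx =>
      obtain ⟨a, b, rfl⟩ := hx
      by_cases h0 : (a + b * Real.sqrt d : ℝ) = 0
      · exact ⟨0, 0, by simp [h0]⟩
      by_cases h : (a - b * Real.sqrt d : ℝ) = 0
      · refine ⟨1 / (2 * a), 0, ?_⟩
        have h2 : (a + b * Real.sqrt d : ℝ) = 2 * a := by linear_combination -h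
        rw [h2]
        push_cast
        simp
      · have hN : (a ^ 2 - d * b ^ 2 : ℝ) ≠ 0 := by
          have := mul_ne_zero h0 h
          intro hN
          apply this
          linear_combination hN - (b ^ 2 : ℝ) * hs
        refine ⟨a / (a ^ 2 - d * b ^ 2), -b / (a ^ 2 - d * b ^ 2), ?_⟩
        push_cast
        rw [inv_eq_iff_eq_inv, eq_comm, inv_eq_iff_eq_inv, eq_comm, ← one_div, div_eq_iff h0]
        field_simp
        linear_combination (b ^ 2 : ℝ) * hs
  · rintro ⟨x, y, rfl⟩
    refine add_mem ?_ (mul_mem ?_ (IntermediateField.mem_adjoin_simple_self ℚ _))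
    · exact (IntermediateField.adjoin ℚ {Real.sqrt (d : ℝ)}).algebraMap_mem x
    · exact (IntermediateField.adjoin ℚ {Real.sqrt (d : ℝ)}).algebraMap_mem y

theorem add_mul_sqrt_ne_zero {d : ℕ} (hd : ¬ IsSquare d) {x y : ℚ} (h : x ≠ 0 ∨ y ≠ 0) :
    (x + y * Real.sqrt d : ℝ) ≠ 0 := by
  intro h0
  by_cases hy : y = 0
  · subst hy
    simp at h h0
    exact h h0
  · refine irrational_sqrt_natCast_iff.2 hd ⟨-x / y, ?_⟩
    have : (y : ℝ) ≠ 0 := Rat.cast_ne_zero.2 hy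
    push_cast
    rw [div_eq_iff this]
    linear_combination -h0

/-- A partial retraction of the reals onto a rational subspace, killing a disjoint one. -/
theorem exists_linearMap_eq_self_and_eq_zero {p q : Submodule ℚ ℝ} (h : Disjoint p q) :
    ∃ f : ℝ →ₗ[ℚ] ℝ, (∀ x ∈ p, f x = x) ∧ ∀ x ∈ q, f x = 0 := by
  have hinj : LinearMap.ker (p.subtype.coprod q.subtype) = ⊥ := by
    rw [LinearMap.ker_coprod_of_disjoint_range]
    · simp
    · simpa using h
  obtain ⟨ρ, hρ⟩ := LinearMap.exists_leftInverse_of_injective _ hinj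
  refine ⟨p.subtype ∘ₗ LinearMap.fst ℚ p q ∘ₗ ρ, fun x hx => ?_, fun x hx => ?_⟩
  · have := LinearMap.congr_fun hρ (⟨x, hx⟩, 0)
    simp at this
    simp [this]
  · have := LinearMap.congr_fun hρ (0, ⟨x, hx⟩)
    simp at this
    simp [this]

theorem wedge_one_sqrt_ne_zero {d : ℕ} (hd : ¬ IsSquare d) :
    wedge (1 : ℝ) (Real.sqrt d) ≠ 0 := by
  intro h
  have hdis : Disjoint (Submodule.span ℚ {(1 : ℝ)}) (Submodule.span ℚ {Real.sqrt d}) := by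
    rw [Submodule.disjoint_def]
    intro z h1 h2
    obtain ⟨x, rfl⟩ := Submodule.mem_span_singleton.1 h1
    obtain ⟨y, hy⟩ := Submodule.mem_span_singleton.1 h2
    by_contra hne
    have hx : x ≠ 0 := by
      rintro rfl
      simp at hne
    refine add_mul_sqrt_ne_zero hd (x := x) (y := -y) (Or.inl hx) ?_
    simp only [Rat.smul_def, mul_one] at hy
    push_cast
    linear_combination -hy
  obtain ⟨f, hf1, hf2⟩ := exists_linearMap_eq_self_and_eq_zero hdis
  have e1 : f 1 = 1 := hf1 _ (Submodule.mem_span_singleton_self _)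
  have e2 : f (Real.sqrt d) = 0 := hf2 _ (Submodule.mem_span_singleton_self _)
  have key := congrArg (fun z => LinearMap.mul' ℚ ℝ (KenyonSmillie.Jxy
    (exteriorPower.map 2 (LinearMap.pi ![f, LinearMap.id]) z))) h
  simp only [map_wedge, KenyonSmillie.Jxy, alternatingMapLinearEquiv_wedge, map_zero] at key
  simp [KenyonSmillie.crossAlt, e1, e2] at key
  exact hd ⟨0, by simp [key]⟩

end Quadratic

section Forms

/-- The linear form `u ↦ a₀ u₀ + a₁ u₁` on the plane, as a `ℚ`-linear map. -/
noncomputable def form (a : Plane) : Plane →ₗ[ℚ] ℝ where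
  toFun u := a 0 * u 0 + a 1 * u 1
  map_add' u v := by simp; ring
  map_smul' c u := by simp [Rat.smul_def]; ring

theorem form_apply (a u : Plane) : form a u = a 0 * u 0 + a 1 * u 1 := rfl

/-- The determinant of two vectors. -/
def planeDet (a b : Plane) : ℝ := a 0 * b 1 - a 1 * b 0

/-- The map `u ∧ v ↦ α(u) ⊗ β(v) - α(v) ⊗ β(u)`. -/
noncomputable def cross (α β : Plane →ₗ[ℚ] ℝ) : ⋀[ℚ]^2 Plane →ₗ[ℚ] ℝ ⊗[ℚ] ℝ :=
  KenyonSmillie.Jxy ∘ₗ exteriorPower.map 2 (LinearMap.pi ![α, β])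

theorem cross_wedge (α β : Plane →ₗ[ℚ] ℝ) (u v : Plane) :
    cross α β (wedge u v) = α u ⊗ₜ β v - α v ⊗ₜ β u := by
  rw [cross, LinearMap.comp_apply, map_wedge, KenyonSmillie.Jxy, alternatingMapLinearEquiv_wedge]
  simp [KenyonSmillie.crossAlt]

theorem Jxy_wedge (u v : Plane) :
    KenyonSmillie.Jxy (wedge u v) = u 0 ⊗ₜ v 1 - v 0 ⊗ₜ u 1 := by
  rw [KenyonSmillie.Jxy, alternatingMapLinearEquiv_wedge]
  simp [KenyonSmillie.crossAlt]

theorem Jyx_wedge (u v : Plane) :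
    KenyonSmillie.Jyx (wedge u v) = u 1 ⊗ₜ v 0 - v 1 ⊗ₜ u 0 := by
  rw [KenyonSmillie.Jyx, alternatingMapLinearEquiv_wedge]
  simp [KenyonSmillie.crossAlt]

theorem exteriorPower_two_ext {N : Type} [AddCommGroup N] [Module ℚ N]
    {f g : ⋀[ℚ]^2 Plane →ₗ[ℚ] N} (h : ∀ u v, f (wedge u v) = g (wedge u v)) : f = g := by
  apply exteriorPower.linearMap_ext
  ext m
  have hm : m = ![m 0, m 1] := by
    ext i : 1
    fin_cases i <;> rfl
  rw [hm]
  exact h _ _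

theorem mul'_cross_form (a b : Plane) (J : ⋀[ℚ]^2 Plane) :
    LinearMap.mul' ℚ ℝ (cross (form a) (form b) J) =
      planeDet a b * LinearMap.mul' ℚ ℝ (KenyonSmillie.Jxy J) := by
  suffices h : LinearMap.mul' ℚ ℝ ∘ₗ cross (form a) (form b) =
      LinearMap.mulLeft ℚ (planeDet a b) ∘ₗ LinearMap.mul' ℚ ℝ ∘ₗ KenyonSmillie.Jxy from
    LinearMap.congr_fun h J
  refine exteriorPower_two_ext fun u v => ?_
  simp only [LinearMap.comp_apply, cross_wedge, Jxy_wedge, map_sub, LinearMap.mul'_apply,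
    form_apply, planeDet, LinearMap.mulLeft_apply]
  ring

/-- The map `a ⊗ b ↦ (m a) ∧ (n b)`. -/
noncomputable def scaledWedge (m n : ℝ) : ℝ ⊗[ℚ] ℝ →ₗ[ℚ] ⋀[ℚ]^2 ℝ :=
  TensorProduct.lift (wedge.compl₁₂ (LinearMap.mulLeft ℚ m) (LinearMap.mulLeft ℚ n))

theorem scaledWedge_tmul (m n a b : ℝ) :
    scaledWedge m n (a ⊗ₜ b) = wedge (m * a) (n * b) := rfl

theorem map_form_smul (c : ℝ) (a : Plane) (J : ⋀[ℚ]^2 Plane) :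
    exteriorPower.map 2 (form (c • a)) J =
      exteriorPower.map 2 (LinearMap.mulLeft ℚ c) (exteriorPower.map 2 (form a) J) := by
  rw [← LinearMap.comp_apply, ← exteriorPower.map_comp]
  congr 2
  ext u
  simp [form_apply]
  ring

theorem map_form_smul_eq_zero_iff {c : ℝ} (hc : c ≠ 0) (a : Plane) (J : ⋀[ℚ]^2 Plane) :
    exteriorPower.map 2 (form (c • a)) J = 0 ↔ exteriorPower.map 2 (form a) J = 0 := by
  refine ⟨fun h => ?_, fun h => by rw [map_form_smul, h, map_zero]⟩
  have := map_form_smul c⁻¹ (c • a) J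
  rwa [h, map_zero, inv_smul_smul₀ hc] at this

/-- If the form `a` and `b` kill `J`, the value of `m a + n b` on `J` is determined by the mixed
part of `J`. -/
theorem map_form_add_eq_scaledWedge {a b : Plane} {J : ⋀[ℚ]^2 Plane} (m n : ℝ)
    (ha : exteriorPower.map 2 (form a) J = 0) (hb : exteriorPower.map 2 (form b) J = 0) :
    exteriorPower.map 2 (form (m • a + n • b)) J =
      scaledWedge m n (cross (form a) (form b) J) := by
  have h : exteriorPower.map 2 (form (m • a + n • b)) =
      exteriorPower.map 2 (form (m • a)) + exteriorPower.map 2 (form (n • b)) +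
        scaledWedge m n ∘ₗ cross (form a) (form b) := by
    refine exteriorPower_two_ext fun u v => ?_
    simp only [LinearMap.add_apply, LinearMap.comp_apply, map_wedge, cross_wedge, map_sub,
      scaledWedge_tmul]
    have hf : ∀ u, form (m • a + n • b) u = m * form a u + n * form b u := fun u => by
      simp [form_apply]
      ring
    have hs : ∀ (c : ℝ) (a u : Plane), form (c • a) u = c * form a u := fun c a u => by
      simp [form_apply]
      ring
    rw [hf, hf, hs, hs, hs, hs]
    simp only [map_add, LinearMap.add_apply]
    rw [wedge_swap (m * form a v) (n * form b u)]
    abel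
  rw [h, LinearMap.add_apply, LinearMap.add_apply, map_form_smul, map_form_smul, ha, hb, map_zero,
    map_zero, zero_add, zero_add, LinearMap.comp_apply]

theorem wedge_quadratic (d : ℕ) (x y x' y' : ℚ) :
    wedge (x + y * Real.sqrt d : ℝ) (x' + y' * Real.sqrt d : ℝ) =
      (x * y' - y * x') • wedge (1 : ℝ) (Real.sqrt d) := by
  have h : ∀ x y : ℚ, (x + y * Real.sqrt d : ℝ) = x • (1 : ℝ) + y • Real.sqrt d := fun x y => by
    simp [Rat.smul_def]
  rw [h, h]
  simp only [map_add, map_smul, LinearMap.add_apply, LinearMap.smul_apply, wedge_self,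
    wedge_swap (1 : ℝ) (Real.sqrt d)]
  module

theorem scaledWedge_quadTensor (d : ℕ) (x y x' y' c₁ c₂ c₃ c₄ : ℚ) :
    scaledWedge (x + y * Real.sqrt d) (x' + y' * Real.sqrt d) (quadTensor d c₁ c₂ c₃ c₄) =
      ((c₁ - d * c₄) * (x * y' - y * x') + (c₂ - c₃) * (x * x' - d * y * y')) •
        wedge (1 : ℝ) (Real.sqrt d) := by
  have hs : Real.sqrt d * Real.sqrt d = d := Real.mul_self_sqrt (Nat.cast_nonneg d)
  have h : ∀ x y : ℚ, (x + y * Real.sqrt d : ℝ) * Real.sqrt d =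
      ((d * y : ℚ) : ℝ) + x * Real.sqrt d := fun x y => by
    push_cast
    linear_combination (y : ℝ) * hs
  rw [quadTensor, map_add, map_add, map_add]
  simp only [map_smul (scaledWedge _ _), scaledWedge_tmul, mul_one, h, wedge_quadratic]
  module

theorem planeDet_form (a b p q : Plane) :
    form a p * form b q - form b p * form a q = planeDet a b * planeDet p q := by
  simp only [form_apply, planeDet]
  ring

theorem eq_zero_of_form_eq_zero {a b p : Plane} (hab : planeDet a b ≠ 0) (ha : form a p = 0)
    (hb : form b p = 0) : p = 0 := by
  rw [form_apply] at ha hb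
  ext i
  apply mul_left_cancel₀ hab
  rw [planeDet]
  fin_cases i
  · change _ * p 0 = _ * 0
    linear_combination b 1 * ha - a 1 * hb
  · change _ * p 1 = _ * 0
    linear_combination a 0 * hb - b 0 * ha

end Forms

theorem form_add_smul_apply (a b : Plane) (m n : ℝ) (u : Plane) :
    form (m • a + n • b) u = m * form a u + n * form b u := by
  simp [form_apply]
  ring

theorem form_smul_apply (c : ℝ) (a u : Plane) : form (c • a) u = c * form a u := by
  simp [form_apply]
  ring

theorem form_apply_mem {K : IntermediateField ℚ ℝ} {a u : Plane} (ha : ∀ i, a i ∈ K)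
    (hu : ∀ i, u i ∈ K) : form a u ∈ K :=
  add_mem (mul_mem (ha 0) (hu 0)) (mul_mem (ha 1) (hu 1))

/-- A linear form which kills an element of the exterior square of `K²` of nonzero area is
proportional to a form with coefficients in `K`. -/
theorem exists_smul_mem_of_map_form_eq_zero {K : IntermediateField ℚ ℝ} {ι : Type} [Fintype ι]
    {x y : ι → Plane} (hx : ∀ e i, x e i ∈ K) (hy : ∀ e i, y e i ∈ K)
    (hJ : LinearMap.mul' ℚ ℝ (KenyonSmillie.Jxy (∑ e, wedge (x e) (y e))) ≠ 0)
    {a : Plane} (ha : a ≠ 0) (h : exteriorPower.map 2 (form a) (∑ e, wedge (x e) (y e)) = 0) :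
    ∃ s : ℝ, s ≠ 0 ∧ ∀ i, (s • a) i ∈ K := by
  by_cases h0 : a 0 = 0
  · have h1 : a 1 ≠ 0 := fun h1 => ha (by ext i; fin_cases i <;> simp [h0, h1])
    refine ⟨(a 1)⁻¹, inv_ne_zero h1, fun i => ?_⟩
    fin_cases i
    · simp [h0]
    · simp [h1]
  by_cases h1 : a 1 / a 0 ∈ K
  · refine ⟨(a 0)⁻¹, inv_ne_zero h0, fun i => ?_⟩
    fin_cases i
    · simp [h0]
    · simpa [div_eq_inv_mul] using h1
  exfalso
  let V : Submodule ℚ Plane :=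
    { carrier := {u | ∀ i, u i ∈ K}
      add_mem' := fun hu hv i => add_mem (hu i) (hv i)
      zero_mem' := fun i => zero_mem K
      smul_mem' := fun c u hu i => K.smul_mem (hu i) }
  have hinj : LinearMap.ker (form a ∘ₗ V.subtype) = ⊥ := by
    rw [LinearMap.ker_eq_bot']
    rintro ⟨u, hu⟩ hz
    replace hz : a 0 * u 0 + a 1 * u 1 = 0 := hz
    have hu1 : u 1 = 0 := by
      by_contra hne
      apply h1
      have : a 1 / a 0 = -u 0 / u 1 := by
        field_simp
        linear_combination hz
      rw [this]
      exact div_mem (neg_mem (hu 0)) (hu 1)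
    have hu0 : u 0 = 0 := by simpa [hu1, h0] using hz
    ext i
    fin_cases i
    · exact hu0
    · exact hu1
  obtain ⟨ρ, hρ⟩ := LinearMap.exists_leftInverse_of_injective _ hinj
  have hl : ∀ u ∈ V, V.subtype (ρ (form a u)) = u := fun u hu =>
    congrArg V.subtype (LinearMap.congr_fun hρ ⟨u, hu⟩)
  have h2 := congrArg (exteriorPower.map 2 (V.subtype ∘ₗ ρ)) h
  simp only [map_sum, map_wedge, map_zero, LinearMap.comp_apply, hl _ (hx _), hl _ (hy _)] at h2
  exact hJ (by rw [h2, map_zero, map_zero])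

theorem quadTensor_neg (d : ℕ) (c₁ c₂ c₃ c₄ : ℚ) :
    quadTensor d (-c₁) (-c₂) (-c₃) (-c₄) = -quadTensor d c₁ c₂ c₃ c₄ := by
  simp only [quadTensor]
  module

theorem quadTensor_add (d : ℕ) (c₁ c₂ c₃ c₄ c₁' c₂' c₃' c₄' : ℚ) :
    quadTensor d (c₁ + c₁') (c₂ + c₂') (c₃ + c₃') (c₄ + c₄') =
      quadTensor d c₁ c₂ c₃ c₄ + quadTensor d c₁' c₂' c₃' c₄' := by
  simp only [quadTensor]
  module

theorem tmul_eq_quadTensor (d : ℕ) (x y x' y' : ℚ) :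
    (x + y * Real.sqrt d : ℝ) ⊗ₜ[ℚ] (x' + y' * Real.sqrt d : ℝ) =
      quadTensor d (x * x') (x * y') (y * x') (y * y') := by
  have h : ∀ x y : ℚ, (x + y * Real.sqrt d : ℝ) = x • (1 : ℝ) + y • Real.sqrt d := fun x y => by
    simp [Rat.smul_def]
  rw [h, h, quadTensor]
  simp only [TensorProduct.add_tmul, TensorProduct.tmul_add, ← TensorProduct.smul_tmul',
    TensorProduct.tmul_smul]
  module

/-- The tensors `quadTensor d c₁ c₂ c₃ c₄` form a rational subspace. -/
def quadTensorSubgroup (d : ℕ) : AddSubgroup (ℝ ⊗[ℚ] ℝ) where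
  carrier := {T | ∃ c₁ c₂ c₃ c₄ : ℚ, T = quadTensor d c₁ c₂ c₃ c₄}
  add_mem' := by
    rintro _ _ ⟨c₁, c₂, c₃, c₄, rfl⟩ ⟨c₁', c₂', c₃', c₄', rfl⟩
    exact ⟨_, _, _, _, (quadTensor_add d c₁ c₂ c₃ c₄ c₁' c₂' c₃' c₄').symm⟩
  zero_mem' := ⟨0, 0, 0, 0, by simp [quadTensor]⟩
  neg_mem' := by
    rintro _ ⟨c₁, c₂, c₃, c₄, rfl⟩
    exact ⟨_, _, _, _, (quadTensor_neg d c₁ c₂ c₃ c₄).symm⟩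

theorem tmul_mem_quadTensorSubgroup {d : ℕ} {u v : ℝ}
    (hu : u ∈ IntermediateField.adjoin ℚ {Real.sqrt (d : ℝ)})
    (hv : v ∈ IntermediateField.adjoin ℚ {Real.sqrt (d : ℝ)}) :
    u ⊗ₜ[ℚ] v ∈ quadTensorSubgroup d := by
  obtain ⟨x, y, rfl⟩ := (mem_adjoin_sqrt_iff d u).1 hu
  obtain ⟨x', y', rfl⟩ := (mem_adjoin_sqrt_iff d v).1 hv
  exact ⟨_, _, _, _, tmul_eq_quadTensor d x y x' y'⟩

theorem cross_form_sum_mem {d : ℕ} {ι : Type} [Fintype ι] {x y : ι → Plane}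
    (hx : ∀ e i, x e i ∈ IntermediateField.adjoin ℚ {Real.sqrt (d : ℝ)})
    (hy : ∀ e i, y e i ∈ IntermediateField.adjoin ℚ {Real.sqrt (d : ℝ)}) {a b : Plane}
    (ha : ∀ i, a i ∈ IntermediateField.adjoin ℚ {Real.sqrt (d : ℝ)})
    (hb : ∀ i, b i ∈ IntermediateField.adjoin ℚ {Real.sqrt (d : ℝ)}) :
    cross (form a) (form b) (∑ e, wedge (x e) (y e)) ∈ quadTensorSubgroup d := by
  rw [map_sum]
  refine sum_mem fun e _ => ?_
  rw [cross_wedge]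
  exact sub_mem
    (tmul_mem_quadTensorSubgroup (form_apply_mem ha (hx e)) (form_apply_mem hb (hy e)))
    (tmul_mem_quadTensorSubgroup (form_apply_mem ha (hy e)) (form_apply_mem hb (hx e)))

theorem sqrt_mem_adjoin (d : ℕ) :
    Real.sqrt (d : ℝ) ∈ IntermediateField.adjoin ℚ {Real.sqrt (d : ℝ)} :=
  IntermediateField.mem_adjoin_simple_self ℚ _

/-- If `s ∉ K`, there is a retraction to `K` killing `s K`. -/
theorem exists_linearMap_of_notMem {K : IntermediateField ℚ ℝ} {s : ℝ} (hs : s ∉ K) :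
    ∃ f : ℝ →ₗ[ℚ] ℝ, (∀ x ∈ K, f x = x) ∧ ∀ x ∈ K, f (s * x) = 0 := by
  let V : Submodule ℚ ℝ := Subalgebra.toSubmodule K.toSubalgebra
  have hdis : Disjoint V (V.map (LinearMap.mulLeft ℚ s)) := by
    rw [Submodule.disjoint_def]
    rintro _ h1 ⟨x, hx, rfl⟩
    replace h1 : s * x ∈ K := h1
    replace hx : x ∈ K := hx
    by_cases h0 : x = 0
    · simp [h0]
    · exact absurd (by simpa [h0] using div_mem h1 hx) hs
  obtain ⟨f, h1, h2⟩ := exists_linearMap_eq_self_and_eq_zero hdis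
  exact ⟨f, h1, fun x hx => h2 _ ⟨x, hx, rfl⟩⟩

theorem mem_of_cross_eq_quadTensor_left {d : ℕ} {ι : Type} [Fintype ι] {x y : ι → Plane}
    (hx : ∀ e i, x e i ∈ IntermediateField.adjoin ℚ {Real.sqrt (d : ℝ)})
    (hy : ∀ e i, y e i ∈ IntermediateField.adjoin ℚ {Real.sqrt (d : ℝ)}) {a b : Plane} {s : ℝ}
    (hs : s ≠ 0) (ha : ∀ i, (s • a) i ∈ IntermediateField.adjoin ℚ {Real.sqrt (d : ℝ)})
    {c₁ c₂ c₃ c₄ : ℚ}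
    (hT : cross (form a) (form b) (∑ e, wedge (x e) (y e)) = quadTensor d c₁ c₂ c₃ c₄)
    (hne : quadTensor d c₁ c₂ c₃ c₄ ≠ 0) (i : Fin 2) :
    a i ∈ IntermediateField.adjoin ℚ {Real.sqrt (d : ℝ)} := by
  have ha' : a = s⁻¹ • (s • a) := (inv_smul_smul₀ hs a).symm
  by_cases hsK : s⁻¹ ∈ IntermediateField.adjoin ℚ {Real.sqrt (d : ℝ)}
  · rw [ha']
    exact mul_mem hsK (ha i)
  exfalso
  obtain ⟨f, hf1, hf2⟩ := exists_linearMap_of_notMem hsK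
  apply hne
  have h1 : TensorProduct.map f LinearMap.id (quadTensor d c₁ c₂ c₃ c₄) =
      quadTensor d c₁ c₂ c₃ c₄ := by
    simp [quadTensor, hf1 _ (one_mem _), hf1 _ (sqrt_mem_adjoin d)]
  rw [← h1, ← hT, map_sum, map_sum]
  refine Finset.sum_eq_zero fun e _ => ?_
  rw [cross_wedge, map_sub, TensorProduct.map_tmul, TensorProduct.map_tmul, ha',
    form_smul_apply s⁻¹ (s • a) (x e), form_smul_apply s⁻¹ (s • a) (y e),
    hf2 _ (form_apply_mem ha (hx e)), hf2 _ (form_apply_mem ha (hy e))]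
  simp

theorem mem_of_cross_eq_quadTensor_right {d : ℕ} {ι : Type} [Fintype ι] {x y : ι → Plane}
    (hx : ∀ e i, x e i ∈ IntermediateField.adjoin ℚ {Real.sqrt (d : ℝ)})
    (hy : ∀ e i, y e i ∈ IntermediateField.adjoin ℚ {Real.sqrt (d : ℝ)}) {a b : Plane} {s : ℝ}
    (hs : s ≠ 0) (hb : ∀ i, (s • b) i ∈ IntermediateField.adjoin ℚ {Real.sqrt (d : ℝ)})
    {c₁ c₂ c₃ c₄ : ℚ}
    (hT : cross (form a) (form b) (∑ e, wedge (x e) (y e)) = quadTensor d c₁ c₂ c₃ c₄)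
    (hne : quadTensor d c₁ c₂ c₃ c₄ ≠ 0) (i : Fin 2) :
    b i ∈ IntermediateField.adjoin ℚ {Real.sqrt (d : ℝ)} := by
  have hb' : b = s⁻¹ • (s • b) := (inv_smul_smul₀ hs b).symm
  by_cases hsK : s⁻¹ ∈ IntermediateField.adjoin ℚ {Real.sqrt (d : ℝ)}
  · rw [hb']
    exact mul_mem hsK (hb i)
  exfalso
  obtain ⟨f, hf1, hf2⟩ := exists_linearMap_of_notMem hsK
  apply hne
  have h1 : TensorProduct.map LinearMap.id f (quadTensor d c₁ c₂ c₃ c₄) =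
      quadTensor d c₁ c₂ c₃ c₄ := by
    simp [quadTensor, hf1 _ (one_mem _), hf1 _ (sqrt_mem_adjoin d)]
  rw [← h1, ← hT, map_sum, map_sum]
  refine Finset.sum_eq_zero fun e _ => ?_
  rw [cross_wedge, map_sub, TensorProduct.map_tmul, TensorProduct.map_tmul, hb',
    form_smul_apply s⁻¹ (s • b) (x e), form_smul_apply s⁻¹ (s • b) (y e),
    hf2 _ (form_apply_mem hb (hx e)), hf2 _ (form_apply_mem hb (hy e))]
  simp

/-- If three vectors, each proportional to a rational one, are such that the third is the sum of the
first two, which are linearly independent, then the factors of the first two are commensurable. -/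
theorem exists_rat_mul_of_add {r₁ r₂ r₃ : ℝ} {a₁ b₁ a₂ b₂ a₃ b₃ : ℚ}
    (hD : r₁ * a₁ * (r₂ * b₂) - r₁ * b₁ * (r₂ * a₂) ≠ 0)
    (ha : r₁ * a₁ + r₂ * a₂ = r₃ * a₃) (hb : r₁ * b₁ + r₂ * b₂ = r₃ * b₃) :
    ∃ q : ℚ, r₂ = q * r₁ := by
  have h1 : r₁ ≠ 0 := by
    rintro rfl
    simp at hD
  have h2 : r₂ ≠ 0 := by
    rintro rfl
    simp at hD
  have hE : (a₁ * b₂ - b₁ * a₂ : ℝ) ≠ 0 := fun h => hD (by linear_combination r₁ * r₂ * h)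
  have e1 : r₂ * (a₁ * b₂ - b₁ * a₂) = r₃ * (a₁ * b₃ - b₁ * a₃) := by
    linear_combination a₁ * hb - b₁ * ha
  have e2 : r₁ * (a₁ * b₂ - b₁ * a₂) = r₃ * (a₃ * b₂ - b₃ * a₂) := by
    linear_combination b₂ * ha - a₂ * hb
  have h3 : r₃ * (a₃ * b₂ - b₃ * a₂) ≠ 0 := e2 ▸ mul_ne_zero h1 hE
  refine ⟨(a₁ * b₃ - b₁ * a₃) / (a₃ * b₂ - b₃ * a₂), ?_⟩
  push_cast
  have h4 := right_ne_zero_of_mul h3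
  rw [div_mul_eq_mul_div, eq_div_iff h4]
  apply mul_left_cancel₀ hE
  linear_combination (a₃ * b₂ - b₃ * a₂ : ℝ) * e1 - (a₁ * b₃ - b₁ * a₃ : ℝ) * e2

/-- If every element of a group of plane vectors is proportional to a rational vector and the group
spans the plane, then the factor of proportionality can be chosen uniformly. -/
theorem exists_common_scale (L : Submodule ℤ Plane) (a b : Plane)
    (h : ∀ p ∈ L, ∃ (r : ℝ) (x y : ℚ), form a p = r * x ∧ form b p = r * y) {p₁ p₂ : Plane}
    (h₁ : p₁ ∈ L) (h₂ : p₂ ∈ L) (hD : form a p₁ * form b p₂ - form b p₁ * form a p₂ ≠ 0) :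
    ∃ r : ℝ, r ≠ 0 ∧ ∀ p ∈ L, ∃ x y : ℚ, form a p = r * x ∧ form b p = r * y := by
  have hpair : ∀ p ∈ L, ∀ p' ∈ L, ∀ (r r' : ℝ) (x y x' y' : ℚ), form a p = r * x →
      form b p = r * y → form a p' = r' * x' → form b p' = r' * y' →
      form a p * form b p' - form b p * form a p' ≠ 0 → ∃ q : ℚ, r' = q * r := by
    intro p hp p' hp' r r' x y x' y' hx hy hx' hy' hne
    obtain ⟨r₃, x₃, y₃, h3, h3'⟩ := h _ (L.add_mem hp hp')
    rw [map_add, hx, hx'] at h3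
    rw [map_add, hy, hy'] at h3'
    rw [hx, hy, hx', hy'] at hne
    exact exists_rat_mul_of_add hne h3 h3'
  obtain ⟨r₁, x₁, y₁, hx₁, hy₁⟩ := h p₁ h₁
  obtain ⟨r₂, x₂, y₂, hx₂, hy₂⟩ := h p₂ h₂
  obtain ⟨q₂, hq₂⟩ := hpair _ h₁ _ h₂ _ _ _ _ _ _ hx₁ hy₁ hx₂ hy₂ hD
  refine ⟨r₁, fun h0 => hD (by simp [hx₁, hy₁, h0]), fun p hp => ?_⟩
  obtain ⟨r, x, y, hx, hy⟩ := h p hp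
  suffices hr : (∃ q : ℚ, r = q * r₁) ∨ (form a p = 0 ∧ form b p = 0) by
    rcases hr with ⟨q, rfl⟩ | ⟨h1, h2⟩
    · exact ⟨q * x, q * y, by rw [hx]; push_cast; ring, by rw [hy]; push_cast; ring⟩
    · exact ⟨0, 0, by simp [h1], by simp [h2]⟩
  by_cases hd1 : form a p₁ * form b p - form b p₁ * form a p = 0
  · by_cases hd2 : form a p₂ * form b p - form b p₂ * form a p = 0
    · right
      constructor
      · apply mul_left_cancel₀ hD
        linear_combination form a p₂ * hd1 - form a p₁ * hd2
      · apply mul_left_cancel₀ hD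
        linear_combination form b p₂ * hd1 - form b p₁ * hd2
    · obtain ⟨q, hq⟩ := hpair _ h₂ _ hp _ _ _ _ _ _ hx₂ hy₂ hx hy hd2
      exact Or.inl ⟨q * q₂, by rw [hq, hq₂]; push_cast; ring⟩
  · exact Or.inl (hpair _ h₁ _ hp _ _ _ _ _ _ hx₁ hy₁ hx hy hd1)

/-- A rational linear condition on `m n̄`, for `m, n ∈ ℚ(√d)`, determines the slope `m / n` up to a
rational factor. -/
theorem exists_proportional {d : ℕ} (hd : ¬ IsSquare d) {A B x y x' y' : ℚ} (hAB : A ≠ 0 ∨ B ≠ 0)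
    (h : A * (x * y' - y * x') + B * (x * x' - d * y * y') = 0) :
    ∃ (r : ℝ) (q q' : ℚ), (A + B * Real.sqrt d) * (x' + y' * Real.sqrt d : ℝ) = r * q ∧
      (x + y * Real.sqrt d : ℝ) = r * q' := by
  have hs : Real.sqrt d * Real.sqrt d = d := Real.mul_self_sqrt (Nat.cast_nonneg d)
  by_cases h0 : x' = 0 ∧ y' = 0
  · exact ⟨x + y * Real.sqrt d, 0, 1, by simp [h0.1, h0.2], by simp⟩
  have h0' : x' ≠ 0 ∨ y' ≠ 0 := by tauto
  have hN : (x' ^ 2 - d * y' ^ 2 : ℝ) ≠ 0 := by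
    have h1 := add_mul_sqrt_ne_zero hd h0'
    have h2 := add_mul_sqrt_ne_zero hd (x := x') (y := -y') (by simpa using h0')
    intro hN
    apply mul_ne_zero h1 h2
    push_cast
    linear_combination hN - (y' ^ 2 : ℝ) * hs
  have hρ : ∃ ρ : ℚ, x * x' - d * y * y' = ρ * A ∧ y * x' - x * y' = ρ * B := by
    by_cases hA : A = 0
    · have hB : B ≠ 0 := by tauto
      refine ⟨(y * x' - x * y') / B, ?_, (div_mul_cancel₀ _ hB).symm⟩
      rw [hA, mul_zero]
      apply mul_left_cancel₀ hB
      rw [hA] at h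
      linear_combination h
    · refine ⟨(x * x' - d * y * y') / A, (div_mul_cancel₀ _ hA).symm, ?_⟩
      rw [div_mul_eq_mul_div, eq_div_iff hA]
      linear_combination -h
  obtain ⟨ρ, h1, h2⟩ := hρ
  have h1' : (x * x' - d * y * y' : ℝ) = ρ * A := by exact_mod_cast h1
  have h2' : (y * x' - x * y' : ℝ) = ρ * B := by exact_mod_cast h2
  refine ⟨(A + B * Real.sqrt d) * (x' + y' * Real.sqrt d), 1, ρ / (x' ^ 2 - d * y' ^ 2), by simp, ?_⟩
  push_cast
  rw [mul_div_assoc', eq_div_iff hN]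
  linear_combination (x' + y' * Real.sqrt d : ℝ) * h1' +
    Real.sqrt d * (x' + y' * Real.sqrt d : ℝ) * h2' + (x * y' ^ 2 - y * x' * y' : ℝ) * hs

namespace TranslationSurface

open KenyonSmillie

theorem Jvv_eq_map_form (S : TranslationSurface) (v : Plane) :
    S.Jvv v = exteriorPower.map 2 (form (if v 0 = 0 then ![1, 0] else ![-(v 1 / v 0), 1])) S.J := by
  rw [Jvv]
  split_ifs with h
  · rw [Jxx]
    congr 2
    ext u
    simp [form_apply]
  · rw [actSL, J_act, Jyy, ← LinearMap.comp_apply, ← exteriorPower.map_comp]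
    congr 2
    ext u
    simp [form_apply, shear, dotProduct, Matrix.mulVec, Fin.sum_univ_two]

/-- `J_vv` vanishes if and only if the image of `J` under a form killing `v` does. -/
theorem Jvv_eq_zero_iff (S : TranslationSurface) {v a : Plane} (hv : v ≠ 0) (ha : a ≠ 0)
    (hav : form a v = 0) : S.Jvv v = 0 ↔ exteriorPower.map 2 (form a) S.J = 0 := by
  rw [form_apply] at hav
  rw [Jvv_eq_map_form]
  split_ifs with h
  · have hv1 : v 1 ≠ 0 := fun h1 => hv (by ext i; fin_cases i <;> simp [h, h1])
    have ha1 : a 1 = 0 := by simpa [h, hv1] using hav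
    have ha0 : a 0 ≠ 0 := fun h0 => ha (by ext i; fin_cases i <;> simp [ha1, h0])
    have hsm : a = a 0 • ![1, 0] := by ext i; fin_cases i <;> simp [ha1]
    rw [hsm, map_form_smul_eq_zero_iff ha0]
  · have ha0 : a 0 = a 1 * -(v 1 / v 0) := by
      field_simp
      linear_combination hav
    have ha1 : a 1 ≠ 0 := fun h1 => ha (by ext i; fin_cases i <;> simp [ha0, h1])
    have hsm : a = a 1 • ![-(v 1 / v 0), 1] := by
      ext i
      fin_cases i
      · simpa using ha0
      · simp
    rw [hsm, map_form_smul_eq_zero_iff ha1]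

theorem Jxy_act (S : TranslationSurface) (g : Matrix.SpecialLinearGroup (Fin 2) ℝ) :
    Jxy (S.actSL g).J = cross (form (g.1 0)) (form (g.1 1)) S.J := by
  rw [actSL, J_act, ← LinearMap.comp_apply]
  congr 1
  refine exteriorPower_two_ext fun u v => ?_
  rw [LinearMap.comp_apply, map_wedge, Jxy_wedge, cross_wedge]
  simp [form_apply, dotProduct, Matrix.mulVec, Fin.sum_univ_two]

theorem Jyx_eq_cross (S : TranslationSurface) :
    Jyx S.J = cross (form ![0, 1]) (form ![1, 0]) S.J := by
  congr 1
  refine exteriorPower_two_ext fun u v => ?_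
  rw [Jyx_wedge, cross_wedge]
  simp [form_apply]

/-- A value of `J_vw` is the cross term of `J` for two independent forms which kill `w` and `v`. -/
theorem IsJvw.exists_forms {S : TranslationSurface} {v w : Plane} {T : ℝ ⊗[ℚ] ℝ}
    (h : S.IsJvw v w T) : ∃ a b : Plane, form a w = 0 ∧ form b v = 0 ∧ planeDet a b ≠ 0 ∧
      T = cross (form a) (form b) S.J := by
  rcases h with ⟨hv, hw, rfl⟩ | ⟨-, s, t, g, hs, ht, hgv, hgw, rfl⟩
  · exact ⟨![0, 1], ![1, 0], by simp [form_apply, hw], by simp [form_apply, hv],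
      by simp [planeDet], S.Jyx_eq_cross⟩
  · refine ⟨g.1 0, g.1 1, ?_, ?_, ?_, S.Jxy_act g⟩
    · have := congrFun hgw 0
      simp [dotProduct, Matrix.mulVec, Fin.sum_univ_two] at this
      apply mul_left_cancel₀ ht
      rw [form_apply]
      linear_combination this
    · have := congrFun hgv 1
      simp [dotProduct, Matrix.mulVec, Fin.sum_univ_two] at this
      apply mul_left_cancel₀ hs
      rw [form_apply]
      linear_combination this
    · have := g.2
      rw [Matrix.det_fin_two] at this
      rw [planeDet, this]
      exact one_ne_zero

/-- Conversely, two forms of determinant one which kill `w` and `v` give a value of `J_vw`, unless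
`v` is vertical and `w` is horizontal. -/
theorem isJvw_cross (S : TranslationSurface) {v w : Plane} (hne : ¬ (v 0 = 0 ∧ w 1 = 0))
    (hv : v ≠ 0) (hw : w ≠ 0) {a b : Plane} (haw : form a w = 0) (hbv : form b v = 0)
    (hab : planeDet a b = 1) : S.IsJvw v w (cross (form a) (form b) S.J) := by
  rw [planeDet] at hab
  have hav : form a v ≠ 0 := by
    intro hav
    apply hv
    rw [form_apply] at hav hbv
    ext i
    fin_cases i
    · change v 0 = 0
      linear_combination b 1 * hav - a 1 * hbv - v 0 * hab
    · change v 1 = 0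
      linear_combination a 0 * hbv - b 0 * hav - v 1 * hab
  have hbw : form b w ≠ 0 := by
    intro hbw
    apply hw
    rw [form_apply] at haw hbw
    ext i
    fin_cases i
    · change w 0 = 0
      linear_combination b 1 * haw - a 1 * hbw - w 0 * hab
    · change w 1 = 0
      linear_combination a 0 * hbw - b 0 * haw - w 1 * hab
  obtain ⟨g, hg⟩ : ∃ g : Matrix.SpecialLinearGroup (Fin 2) ℝ, g.1 = Matrix.of ![a, b] :=
    ⟨⟨Matrix.of ![a, b], by rw [Matrix.det_fin_two]; simpa using hab⟩, rfl⟩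
  have hg0 : g.1 0 = a := congrFun hg 0
  have hg1 : g.1 1 = b := congrFun hg 1
  refine Or.inr ⟨hne, (form a v)⁻¹, (form b w)⁻¹, g, inv_ne_zero hav, inv_ne_zero hbw, ?_, ?_, ?_⟩
  · rw [hg, Matrix.mulVec_smul]
    ext i
    fin_cases i
    · simpa [dotProduct, Matrix.mulVec, Fin.sum_univ_two, form_apply] using inv_mul_cancel₀ hav
    · simpa [dotProduct, Matrix.mulVec, Fin.sum_univ_two, form_apply, hav] using Or.inr hbv
  · rw [hg, Matrix.mulVec_smul]
    ext i
    fin_cases i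
    · simpa [dotProduct, Matrix.mulVec, Fin.sum_univ_two, form_apply, hbw] using Or.inr haw
    · simpa [dotProduct, Matrix.mulVec, Fin.sum_univ_two, form_apply] using inv_mul_cancel₀ hbw
  · rw [Jxy_act, hg0, hg1]

theorem chainPeriod_act (S : TranslationSurface) (A : Matrix (Fin 2) (Fin 2) ℝ) (hA : 0 < A.det)
    (c : S.Chain1) : (S.act A hA).chainPeriod c = A.mulVec (S.chainPeriod c) := by
  obtain ⟨c, rfl⟩ := Submodule.mkQ_surjective _ c
  induction c using Finsupp.induction_linear with
  | zero =>
    rw [map_zero, map_zero, Matrix.mulVec_zero]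
    exact map_zero (S.act A hA).chainPeriod
  | add f g hf hg =>
    rw [map_add, map_add, Matrix.mulVec_add, ← hf, ← hg]
    exact map_add (S.act A hA).chainPeriod _ _
  | single e n =>
    have h1 : S.sideRelations.mkQ (Finsupp.single e n) = n • S.sideChain e := by
      rw [sideChain, ← map_smul]
      simp
    rw [h1, map_smul]
    refine (map_smul (S.act A hA).chainPeriod n (S.sideChain e)).trans ?_
    have h2 : (S.act A hA).chainPeriod (S.sideChain e) = (S.act A hA).vec e :=
      (S.act A hA).liftChain_sideChain _ _ e
    have h3 : S.chainPeriod (S.sideChain e) = S.vec e := S.liftChain_sideChain _ _ e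
    refine (congrArg (n • ·) h2).trans ?_
    rw [h3, Matrix.mulVec_smul]
    refine congrArg (n • ·) ?_
    exact SimplePolygon.act_edgeVec A hA _ _

theorem exists_period_act (S : TranslationSurface) (A : Matrix (Fin 2) (Fin 2) ℝ) (hA : 0 < A.det)
    (c : (S.act A hA).H1) : ∃ c' : S.H1, (S.act A hA).period c = A.mulVec (S.period c') := by
  obtain ⟨z, rfl⟩ := Submodule.mkQ_surjective _ c
  exact ⟨Submodule.mkQ _ z, S.chainPeriod_act A hA z.1⟩

/-- Two forms taking commensurable values on the periods rescale the surface to rational periods. -/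
theorem rescalableToRational_of_forms (S : TranslationSurface) {a b : Plane}
    (hab : planeDet a b ≠ 0) {r : ℝ} (hr : r ≠ 0)
    (h : ∀ p ∈ LinearMap.range S.period, ∃ x y : ℚ, form a p = r * x ∧ form b p = r * y) :
    S.RescalableToRational := by
  rw [planeDet] at hab
  have key : ∀ (A : Matrix (Fin 2) (Fin 2) ℝ), 0 < A.det →
      (∀ p ∈ LinearMap.range S.period, ∀ i, ∃ q : ℚ, A.mulVec p i = q) →
      S.RescalableToRational := fun A hA hp => by
    refine ⟨A, hA, fun c i => ?_⟩
    obtain ⟨c', hc'⟩ := S.exists_period_act A hA c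
    rw [hc']
    exact hp _ ⟨c', rfl⟩ i
  have e : ∀ {x z : ℝ}, x = r * z → r⁻¹ * x = z := fun {x z} h => by
    rw [h, inv_mul_cancel_left₀ hr]
  rcases lt_or_gt_of_ne hab with hlt | hlt
  · refine key (r⁻¹ • Matrix.of ![b, a]) ?_ fun p hp i => ?_
    · rw [Matrix.det_smul, Matrix.det_fin_two]
      have : 0 < r⁻¹ ^ 2 := by positivity
      refine mul_pos (by simpa using this) ?_
      simp only [Matrix.of_apply, Matrix.cons_val_zero, Matrix.cons_val_one]
      linarith
    · obtain ⟨x, y, hx, hy⟩ := h p hp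
      rw [Matrix.smul_mulVec]
      fin_cases i
      · refine ⟨y, ?_⟩
        rw [← e hy]
        simp [dotProduct, Fin.sum_univ_two, form_apply]
      · refine ⟨x, ?_⟩
        rw [← e hx]
        simp [dotProduct, Fin.sum_univ_two, form_apply]
  · refine key (r⁻¹ • Matrix.of ![a, b]) ?_ fun p hp i => ?_
    · rw [Matrix.det_smul, Matrix.det_fin_two]
      have : 0 < r⁻¹ ^ 2 := by positivity
      refine mul_pos (by simpa using this) ?_
      simpa using hlt
    · obtain ⟨x, y, hx, hy⟩ := h p hp
      rw [Matrix.smul_mulVec]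
      fin_cases i
      · refine ⟨x, ?_⟩
        rw [← e hx]
        simp [dotProduct, Fin.sum_univ_two, form_apply]
      · refine ⟨y, ?_⟩
        rw [← e hy]
        simp [dotProduct, Fin.sum_univ_two, form_apply]

/-- The periods span the plane. -/
theorem exists_independent_periods (S : TranslationSurface) :
    ∃ p₁ ∈ LinearMap.range S.period, ∃ p₂ ∈ LinearMap.range S.period, planeDet p₁ p₂ ≠ 0 := by
  obtain ⟨x, y, hx, hy, hJ⟩ := S.exists_J_eq_sum_wedge_period
  have h := S.area_pos.ne'
  rw [hJ, map_sum, map_sum] at h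
  obtain ⟨e, -, he⟩ := Finset.exists_ne_zero_of_sum_ne_zero h
  refine ⟨x e, hx e, y e, hy e, fun h0 => he ?_⟩
  rw [Jxy_wedge, map_sub, LinearMap.mul'_apply, LinearMap.mul'_apply, ← h0, planeDet]
  ring

/-- Property X in terms of forms killing the periods. -/
theorem propertyX_iff (S : TranslationSurface) {a b : Plane} (hab : planeDet a b ≠ 0) :
    S.PropertyX ↔ ∀ p ∈ LinearMap.range S.period, p ≠ 0 →
      exteriorPower.map 2 (form (form b p • a + (-form a p) • b)) S.J = 0 := by
  have hne : ∀ p : Plane, p ≠ 0 → form b p • a + (-form a p) • b ≠ 0 := by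
    intro p hp h0
    have h1 : ∀ i, form b p * a i - form a p * b i = 0 := fun i => by
      have := congrFun h0 i
      simp at this
      linear_combination this
    rw [planeDet] at hab
    refine hp (eq_zero_of_form_eq_zero hab ?_ ?_)
    · apply mul_left_cancel₀ hab
      linear_combination a 1 * h1 0 - a 0 * h1 1
    · apply mul_left_cancel₀ hab
      linear_combination b 1 * h1 0 - b 0 * h1 1
  have hz : ∀ p, form (form b p • a + (-form a p) • b) p = 0 := fun p => by
    rw [form_add_smul_apply]
    ring
  constructor
  · rintro hX p ⟨c, rfl⟩ hp
    exact (S.Jvv_eq_zero_iff hp (hne _ hp) (hz _)).1 (hX _ ⟨hp, c, 1, one_ne_zero, one_smul _ _⟩)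
  · rintro h v ⟨hv, c, r, hr, hc⟩
    have hp : S.period c ≠ 0 := hc ▸ smul_ne_zero hr hv
    refine (S.Jvv_eq_zero_iff hv (hne _ hp) ?_).2 (h _ ⟨c, rfl⟩ hp)
    have := hz (S.period c)
    rw [form_apply] at this ⊢
    rw [← hc] at this ⊢
    simp only [Pi.smul_apply, smul_eq_mul] at this ⊢
    apply mul_left_cancel₀ hr
    linear_combination this

end TranslationSurface

theorem planeDet_ne_zero_of_linearIndependent {v w : Plane} (h : LinearIndependent ℝ ![v, w]) :
    planeDet v w ≠ 0 := by
  intro h0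
  rw [planeDet] at h0
  have hv : v ≠ 0 := by simpa using h.ne_zero 0
  rw [LinearIndependent.pair_iff] at h
  have h1 := h (w 0) (-v 0) (by
    ext i
    fin_cases i
    · simp; ring
    · simp; linear_combination -h0)
  have h2 := h (w 1) (-v 1) (by
    ext i
    fin_cases i
    · simp; linear_combination h0
    · simp; ring)
  apply hv
  ext i
  fin_cases i
  · simpa using h1.2
  · simpa using h2.2

/-- The quarter turn of a vector, seen as the coefficients of a form killing the vector. -/
def perp (v : Plane) : Plane := ![-v 1, v 0]

theorem form_perp_self (v : Plane) : form (perp v) v = 0 := by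
  simp [form_apply, perp]
  ring

theorem perp_ne_zero {v : Plane} (hv : v ≠ 0) : perp v ≠ 0 := by
  intro h
  apply hv
  have h0 := congrFun h 0
  have h1 := congrFun h 1
  simp [perp] at h0 h1
  ext i
  fin_cases i
  · exact h1
  · exact h0

theorem proposition1 (S : TranslationSurface) (d : ℕ) (hd : S.IsQuadraticWith d)
    (hS : ¬ S.RescalableToRational) (v w : Plane) (hvw : LinearIndependent ℝ ![v, w])
    (hv : S.Jvv v = 0) (hw : S.Jvv w = 0) :
    (∃ (T : TensorProduct ℚ ℝ ℝ) (c₁ c₂ c₃ c₄ : ℚ),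
      S.IsJvw v w T ∧ T = quadTensor d c₁ c₂ c₃ c₄) ∧
    ∀ (T : TensorProduct ℚ ℝ ℝ) (c₁ c₂ c₃ c₄ : ℚ),
      S.IsJvw v w T → T = quadTensor d c₁ c₂ c₃ c₄ →
        (S.PropertyX ↔ c₂ = c₃ ∧ c₁ = d * c₄) := by
  obtain ⟨-, hsq, hK⟩ := hd
  have hv0 : v ≠ 0 := by simpa using hvw.ne_zero 0
  have hw0 : w ≠ 0 := by simpa using hvw.ne_zero 1
  have hdet := planeDet_ne_zero_of_linearIndependent hvw
  have hL : ∀ p ∈ LinearMap.range S.period, ∀ i,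
      p i ∈ IntermediateField.adjoin ℚ {Real.sqrt (d : ℝ)} := by
    rintro _ ⟨c, rfl⟩ i
    exact hK c i
  obtain ⟨x, y, hx, hy, hJ⟩ := S.exists_J_eq_sum_wedge_period
  have hx' := fun e => hL _ (hx e)
  have hy' := fun e => hL _ (hy e)
  have harea := S.area_pos.ne'
  have hscale : ∀ {a u : Plane}, u ≠ 0 → a ≠ 0 → form a u = 0 → S.Jvv u = 0 → ∃ s : ℝ, s ≠ 0 ∧
      ∀ i, (s • a) i ∈ IntermediateField.adjoin ℚ {Real.sqrt (d : ℝ)} := by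
    intro a u hu ha hau h
    rw [S.Jvv_eq_zero_iff hu ha hau, hJ] at h
    exact exists_smul_mem_of_map_form_eq_zero hx' hy' (hJ ▸ harea) ha h
  constructor
  · by_cases hvert : v 0 = 0 ∧ w 1 = 0
    · have hm := cross_form_sum_mem hx' hy' (a := ![0, 1]) (b := ![1, 0])
        (fun i => by fin_cases i <;> simp [zero_mem, one_mem])
        (fun i => by fin_cases i <;> simp [zero_mem, one_mem])
      rw [← hJ] at hm
      obtain ⟨c₁, c₂, c₃, c₄, hc⟩ := hm
      exact ⟨_, c₁, c₂, c₃, c₄, Or.inl ⟨hvert.1, hvert.2, rfl⟩, S.Jyx_eq_cross.trans hc⟩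
    · obtain ⟨s, hs, ha⟩ := hscale hw0 (perp_ne_zero hw0) (form_perp_self w) hw
      obtain ⟨t, ht, hb⟩ := hscale hv0 (perp_ne_zero hv0) (form_perp_self v) hv
      have hD : planeDet (s • perp w) (t • perp v) ≠ 0 := by
        have : planeDet (s • perp w) (t • perp v) = -(s * t * planeDet v w) := by
          simp [planeDet, perp]
          ring
        rw [this]
        exact neg_ne_zero.2 (mul_ne_zero (mul_ne_zero hs ht) hdet)
      have hDK : planeDet (s • perp w) (t • perp v) ∈
          IntermediateField.adjoin ℚ {Real.sqrt (d : ℝ)} :=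
        sub_mem (mul_mem (ha 0) (hb 1)) (mul_mem (ha 1) (hb 0))
      set D := planeDet (s • perp w) (t • perp v) with hDdef
      have hm := cross_form_sum_mem hx' hy' ha (b := D⁻¹ • t • perp v)
        (fun i => mul_mem (inv_mem hDK) (hb i))
      rw [← hJ] at hm
      obtain ⟨c₁, c₂, c₃, c₄, hc⟩ := hm
      refine ⟨_, c₁, c₂, c₃, c₄, S.isJvw_cross hvert hv0 hw0 ?_ ?_ ?_, hc⟩
      · rw [form_smul_apply, form_perp_self, mul_zero]
      · rw [form_smul_apply, form_smul_apply, form_perp_self, mul_zero, mul_zero]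
      · have : planeDet (s • perp w) (D⁻¹ • t • perp v) = D⁻¹ * D := by
          rw [hDdef]
          simp [planeDet]
          ring
        rw [this, inv_mul_cancel₀ hD]
  · intro T c₁ c₂ c₃ c₄ hT hTq
    obtain ⟨a, b, haw, hbv, hab, hTc⟩ := hT.exists_forms
    have ha0 : a ≠ 0 := by
      rintro rfl
      simp [planeDet] at hab
    have hb0 : b ≠ 0 := by
      rintro rfl
      simp [planeDet] at hab
    obtain ⟨s, hs, hsa⟩ := hscale hw0 ha0 haw hw
    obtain ⟨t, ht, htb⟩ := hscale hv0 hb0 hbv hv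
    have hcross : cross (form a) (form b) S.J = quadTensor d c₁ c₂ c₃ c₄ := hTc.symm.trans hTq
    have hne : quadTensor d c₁ c₂ c₃ c₄ ≠ 0 := by
      intro h0
      have := mul'_cross_form a b S.J
      rw [hcross, h0, map_zero] at this
      exact mul_ne_zero hab harea this.symm
    have haK := mem_of_cross_eq_quadTensor_left hx' hy' hs hsa (hJ ▸ hcross) hne
    have hbK := mem_of_cross_eq_quadTensor_right hx' hy' ht htb (hJ ▸ hcross) hne
    rw [S.Jvv_eq_zero_iff hw0 ha0 haw] at hw
    rw [S.Jvv_eq_zero_iff hv0 hb0 hbv] at hv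
    have hval : ∀ p (m₀ m₁ n₀ n₁ : ℚ), form b p = m₀ + m₁ * Real.sqrt d →
        -form a p = n₀ + n₁ * Real.sqrt d →
        exteriorPower.map 2 (form (form b p • a + (-form a p) • b)) S.J =
          ((c₁ - d * c₄) * (m₀ * n₁ - m₁ * n₀) + (c₂ - c₃) * (m₀ * n₀ - d * m₁ * n₁)) •
            wedge (1 : ℝ) (Real.sqrt d) := by
      intro p m₀ m₁ n₀ n₁ hm hn
      rw [map_form_add_eq_scaledWedge _ _ hw hv, hcross, hm, hn, scaledWedge_quadTensor]
    have hcoord : ∀ p ∈ LinearMap.range S.period, ∃ m₀ m₁ n₀ n₁ : ℚ,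
        form b p = m₀ + m₁ * Real.sqrt d ∧ -form a p = n₀ + n₁ * Real.sqrt d := by
      intro p hp
      obtain ⟨m₀, m₁, hm⟩ := (mem_adjoin_sqrt_iff d _).1 (form_apply_mem hbK (hL p hp))
      obtain ⟨n₀, n₁, hn⟩ := (mem_adjoin_sqrt_iff d _).1 (neg_mem (form_apply_mem haK (hL p hp)))
      exact ⟨m₀, m₁, n₀, n₁, hm, hn⟩
    rw [S.propertyX_iff hab]
    constructor
    · intro hX
      by_contra hcon
      have hAB : c₁ - d * c₄ ≠ 0 ∨ c₂ - c₃ ≠ 0 := by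
        rw [sub_ne_zero, sub_ne_zero]
        tauto
      have hκ := add_mul_sqrt_ne_zero hsq hAB
      set κ : ℝ := ((c₁ - d * c₄ : ℚ) : ℝ) + ((c₂ - c₃ : ℚ) : ℝ) * Real.sqrt d with hκdef
      have hdet' : planeDet ((-κ) • a) b ≠ 0 := by
        have : planeDet ((-κ) • a) b = -κ * planeDet a b := by
          simp [planeDet]
          ring
        rw [this]
        exact mul_ne_zero (neg_ne_zero.2 hκ) hab
      obtain ⟨p₁, hp₁, p₂, hp₂, hp⟩ := S.exists_independent_periods
      have hprop : ∀ p ∈ LinearMap.range S.period, ∃ (r : ℝ) (x y : ℚ),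
          form ((-κ) • a) p = r * x ∧ form b p = r * y := by
        intro p hpL
        by_cases hp0 : p = 0
        · exact ⟨0, 0, 0, by simp [hp0], by simp [hp0]⟩
        obtain ⟨m₀, m₁, n₀, n₁, hm, hn⟩ := hcoord p hpL
        have h0 := hX p hpL hp0
        rw [hval p _ _ _ _ hm hn, smul_eq_zero] at h0
        obtain ⟨r, q, q', h1, h2⟩ :=
          exists_proportional hsq hAB (h0.resolve_right (wedge_one_sqrt_ne_zero hsq))
        refine ⟨r, q, q', ?_, hm.trans h2⟩
        rw [← h1, ← hn, form_smul_apply, ← hκdef]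
        ring
      obtain ⟨r, hr, hrat⟩ := exists_common_scale _ _ _ hprop hp₁ hp₂
        (by rw [planeDet_form]; exact mul_ne_zero hdet' hp)
      exact hS (S.rescalableToRational_of_forms hdet' hr hrat)
    · rintro ⟨h1, h2⟩ p hpL -
      obtain ⟨m₀, m₁, n₀, n₁, hm, hn⟩ := hcoord p hpL
      rw [hval p _ _ _ _ hm hn, h1, h2]
      simp
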